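/- For positive integers $i_1,\dots,i_k$ with $i_1\ge 2$, define the multiple zeta value and the multiple $t$-value by \[ \zeta(i_1,\dots,i_k)=\sum_{n_1>n_2>\cdots>n_k\ge 1}\frac{1}{n_1^{i_1}n_2^{i_2}\cdots n_k^{i_k}}, \qquad t(i_1,\dots,i_k)=\sum_{\substack{n_1>n_2>\cdots>n_k\ge 1\\ n_1,\dots,n_k\ \mathrm{odd}}}\frac{1}{n_1^{i_1}n_2^{i_2}\cdots n_k^{i_k}}, \] and let $\{2\}^n$ denote the sequence $2,2,\dots,2$ of length $n$. Then for every integer $n\ge 0$, \[ \frac{\zeta(3,\{2\}^n)}{2^{2n+3}}=\frac{2}{\pi}\int_0^1\frac{\arcsin^{2n+2}x}{(2n+2)!}\,\frac{\arccos x}{x}\,dx \qquad\text{and}\qquad t(3,\{2\}^n)=\int_0^1\frac{\arcsin^{2n+1}x}{(2n+1)!}\,\frac{\arccos x}{x}\,dx, \] where both series converge and both integrands are integrable on $[0,1]$. -/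

import Mathlib

noncomputable section

/-- The term `1 / (n₁ ^ i₁ * n₂ ^ i₂ * ⋯ * n_k ^ i_k)`. -/
def multipleSumTerm {k : ℕ} (i : Fin k → ℕ) (n : Fin k → ℕ) : ℝ :=
  1 / ∏ j, (n j : ℝ) ^ i j

/-- The tuples `n₁ > n₂ > ⋯ > n_k` of positive integers. -/
def decreasingTuples (k : ℕ) : Set (Fin k → ℕ) :=
  {n | StrictAnti n ∧ ∀ j, 0 < n j}

/-- The tuples `n₁ > n₂ > ⋯ > n_k` of odd positive integers. -/
def oddDecreasingTuples (k : ℕ) : Set (Fin k → ℕ) :=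
  {n | StrictAnti n ∧ ∀ j, Odd (n j)}

/-- The multiple zeta value `ζ(i₁, …, i_k)`. -/
def multipleZeta {k : ℕ} (i : Fin k → ℕ) : ℝ :=
  ∑' n : decreasingTuples k, multipleSumTerm i n

/-- The multiple `t`-value `t(i₁, …, i_k)`. -/
def multipleT {k : ℕ} (i : Fin k → ℕ) : ℝ :=
  ∑' n : oddDecreasingTuples k, multipleSumTerm i n

/-- The index `(3, {2}ⁿ) = (3, 2, …, 2)` with `n` twos. -/
def threeTwos (n : ℕ) : Fin (n + 1) → ℕ :=
  Matrix.vecCons 3 fun _ => 2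

end

open scoped ENNReal
open MeasureTheory Filter Topology

/-! Write `W k` for the Wallis integral and `e k = sin ^ k / (k ^ 2 * W k)`. Since `(sin ^ k)'' = k
(k - 1) sin ^ (k - 2) - k ^ 2 sin ^ k`, integrating `e k` twice from `0` gives a telescoping series:
the result is `1 / k ^ 2` times the sum of `e l` over `l = k + 2, k + 4, …`
(`lintegral_sub_mul_sinPowTerm`). The same telescoping expands `t` in the odd `e k` and `(2 / π) * t
^ 2 / 2` in the even ones with `k ≥ 2`. Integrating twice `n` more times turns the left side into `t
^ (2 * n + p) / (2 * n + p)!`, with `p = 1` or `2`, and builds the nested sum of inverse squares on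
the right (`tsum_nestedSum_mul_sinPowTerm`).

Now put `t = arcsin x` and integrate against `arccos x / x`. As `∫ x ^ (k - 1) * arccos x = W k /
k`, the Wallis factor cancels and `e k` contributes `1 / k ^ 3`, the leading factor of the series.
Odd `k` give `t(3, {2}ⁿ)`; even `k` give `ζ(3, {2}ⁿ) / 2 ^ (2 * n + 3)`. All terms are nonnegative,
so the interchanges are done in `ℝ≥0∞`, and summability follows from the finite value. -/

/-! ### Sums over strictly decreasing tuples as nested sums -/

theorem strictAnti_finCons_iff {n : ℕ} (i : ℕ) (v : Fin n → ℕ) :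
    StrictAnti (Fin.cons i v : Fin (n + 1) → ℕ) ↔ StrictAnti v ∧ ∀ j, v j < i := by
  constructor
  · intro h
    refine ⟨fun a b hab => ?_, fun j => ?_⟩
    · simpa using h (Fin.succ_lt_succ_iff.2 hab)
    · simpa using h (Fin.succ_pos j)
  · rintro ⟨h, hi⟩ a b hab
    induction b using Fin.cases with
    | zero => exact absurd hab (Fin.not_lt_zero a)
    | succ b =>
      induction a using Fin.cases with
      | zero => simpa using hi b
      | succ a => simpa using h (Fin.succ_lt_succ_iff.1 hab)

theorem ENNReal.tsum_fin_succ {n : ℕ} (f : (Fin (n + 1) → ℕ) → ℝ≥0∞) :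
    ∑' v, f v = ∑' (i : ℕ) (v : Fin n → ℕ), f (Fin.cons i v) := by
  rw [← ENNReal.tsum_prod, ← (Fin.consEquiv fun _ : Fin (n + 1) => ℕ).tsum_eq]
  rfl

/-- The sum of `w j₁ * ⋯ * w jₙ` over all `i > j₁ > ⋯ > jₙ`. -/
noncomputable def nestedSum (w : ℕ → ℝ≥0∞) : ℕ → ℕ → ℝ≥0∞
  | 0, _ => 1
  | n + 1, i => ∑' j, if j < i then w j * nestedSum w n j else 0

open Classical in
theorem tsum_strictAnti_lt_eq_nestedSum (w : ℕ → ℝ≥0∞) (n i : ℕ) :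
    (∑' v : Fin n → ℕ, if StrictAnti v ∧ ∀ j, v j < i then ∏ j, w (v j) else 0) =
      nestedSum w n i := by
  induction n generalizing i with
  | zero =>
    rw [tsum_eq_single default fun v hv => absurd (Subsingleton.elim v _) hv, if_pos]
    · simp [nestedSum]
    · exact ⟨Subsingleton.strictAnti _, fun j => j.elim0⟩
  | succ n ih =>
    rw [ENNReal.tsum_fin_succ, nestedSum]
    refine tsum_congr fun j => ?_
    rw [← ih, ← ENNReal.tsum_mul_left]
    by_cases hj : j < i
    · rw [if_pos hj]
      refine tsum_congr fun v => ?_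
      rw [Fin.prod_univ_succ, mul_ite, mul_zero]
      simp only [strictAnti_finCons_iff, Fin.cons_zero, Fin.cons_succ]
      refine if_congr ⟨fun h => h.1, fun h => ⟨h, ?_⟩⟩ rfl rfl
      refine Fin.cases (by simpa using hj) fun k => ?_
      simpa using (h.2 k).trans hj
    · rw [if_neg hj, ENNReal.tsum_eq_zero]
      exact fun v => if_neg fun h => hj (by simpa using h.2 0)

/-- The largest entry keeps its own weight because its exponent is 3 while the others are 2. -/
theorem tsum_strictAnti_eq_tsum_nestedSum (w₀ w : ℕ → ℝ≥0∞) (n : ℕ) :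
    (∑' v : {v : Fin (n + 1) → ℕ | StrictAnti v},
      w₀ (v.1 0) * ∏ j : Fin n, w (v.1 j.succ)) = ∑' i, w₀ i * nestedSum w n i := by
  classical
  rw [tsum_subtype {v : Fin (n + 1) → ℕ | StrictAnti v}
    fun v => w₀ (v 0) * ∏ j : Fin n, w (v j.succ), ENNReal.tsum_fin_succ]
  refine tsum_congr fun i => ?_
  rw [← tsum_strictAnti_lt_eq_nestedSum, ← ENNReal.tsum_mul_left]
  refine tsum_congr fun v => ?_
  simp only [Set.indicator_apply, Set.mem_ofPred_eq, strictAnti_finCons_iff, mul_ite, mul_zero,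
    Fin.cons_zero, Fin.cons_succ]

/-- Subtracting one from each entry. -/
def decreasingTuplesEquiv (k : ℕ) : {v : Fin k → ℕ | StrictAnti v} ≃ decreasingTuples k where
  toFun v := ⟨fun j => v.1 j + 1, fun _ _ h => Nat.succ_lt_succ (v.2 h), fun _ => Nat.succ_pos _⟩
  invFun n := ⟨fun j => n.1 j - 1, fun a b h => by
    have h₁ := n.2.1 h
    have h₂ := n.2.2 b
    change n.1 b - 1 < n.1 a - 1
    omega⟩
  left_inv v := by ext; simp
  right_inv n := by
    ext j
    exact Nat.sub_add_cancel (n.2.2 j)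

/-- Writing each entry as `2 * v + 1`. -/
def oddDecreasingTuplesEquiv (k : ℕ) :
    {v : Fin k → ℕ | StrictAnti v} ≃ oddDecreasingTuples k where
  toFun v := ⟨fun j => 2 * v.1 j + 1, fun a b h => by
    have h₁ := v.2 h
    change 2 * v.1 b + 1 < 2 * v.1 a + 1
    omega, fun j => odd_two_mul_add_one _⟩
  invFun n := ⟨fun j => n.1 j / 2, fun a b h => by
    have h₁ := n.2.1 h
    obtain ⟨c, hc⟩ := n.2.2 a
    obtain ⟨d, hd⟩ := n.2.2 b
    change n.1 b / 2 < n.1 a / 2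
    omega⟩
  left_inv v := by
    ext j
    change (2 * v.1 j + 1) / 2 = v.1 j
    omega
  right_inv n := by
    ext j
    obtain ⟨c, hc⟩ := n.2.2 j
    change 2 * (n.1 j / 2) + 1 = n.1 j
    omega

theorem multipleSumTerm_threeTwos {n : ℕ} (m : Fin (n + 1) → ℕ) :
    multipleSumTerm (threeTwos n) m =
      1 / (m 0 : ℝ) ^ 3 * ∏ j : Fin n, 1 / (m j.succ : ℝ) ^ 2 := by
  simp [multipleSumTerm, threeTwos, Fin.prod_univ_succ, mul_comm]

/-! ### Wallis integrals -/

/-- The Wallis integral `∫ sin ^ m` over `[0, π / 2]`. -/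
noncomputable def wallisIntegral (m : ℕ) : ℝ := ∫ x in (0 : ℝ)..Real.pi / 2, Real.sin x ^ m

theorem wallisIntegral_zero : wallisIntegral 0 = Real.pi / 2 := by simp [wallisIntegral]

theorem wallisIntegral_one : wallisIntegral 1 = 1 := by simp [wallisIntegral]

theorem wallisIntegral_add_two (m : ℕ) :
    wallisIntegral (m + 2) = (m + 1) / (m + 2) * wallisIntegral m := by
  simp [wallisIntegral, integral_sin_pow]

theorem wallisIntegral_pos (m : ℕ) : 0 < wallisIntegral m := by
  induction m using Nat.twoStepInduction with
  | zero => rw [wallisIntegral_zero]; positivity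
  | one => rw [wallisIntegral_one]; positivity
  | more m h _ => rw [wallisIntegral_add_two]; positivity

/-- A crude bound, enough for the geometric decay of `sin t ^ k` to beat `1 / W k`. It propagates
because `(k + 2) * W (k + 2) = (k + 1) * W k`. -/
theorem one_le_mul_wallisIntegral (m : ℕ) : 1 ≤ (m + 1) * wallisIntegral (m + 1) := by
  induction m using Nat.twoStepInduction with
  | zero => simp [wallisIntegral_one]
  | one =>
    have := Real.pi_gt_three
    rw [wallisIntegral_add_two 0, wallisIntegral_zero]
    norm_num
    linarith
  | more m h _ =>
    refine h.trans ?_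
    rw [show m + 2 + 1 = m + 1 + 2 from rfl, wallisIntegral_add_two (m + 1)]
    have hW := wallisIntegral_pos (m + 1)
    push_cast
    field_simp
    linarith

/-! ### Twofold antiderivatives and expansions in powers of the sine -/

theorem integral_sub_mul_pow_div_factorial (k : ℕ) (t : ℝ) :
    ∫ s in (0 : ℝ)..t, (t - s) * (s ^ k / (k.factorial : ℝ)) =
      t ^ (k + 2) / ((k + 2).factorial : ℝ) := by
  rw [intervalIntegral.integral_eq_sub_of_hasDerivAt (f := fun s =>
    (t - s) * (s ^ (k + 1) / ((k + 1).factorial : ℝ)) + s ^ (k + 2) / ((k + 2).factorial : ℝ))]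
  · simp
  · intro s _
    refine ((((hasDerivAt_id s).const_sub t).mul
      ((hasDerivAt_pow (k + 1) s).div_const ((k + 1).factorial : ℝ))).add
      ((hasDerivAt_pow (k + 2) s).div_const ((k + 2).factorial : ℝ))).congr_deriv ?_
    simp only [id, Nat.add_sub_cancel, Nat.factorial_succ]
    have h : (k.factorial : ℝ) ≠ 0 := by positivity
    push_cast
    field_simp
    ring_nf
  · exact Continuous.intervalIntegrable (by fun_prop) _ _

/-- The twofold antiderivative of `sin ^ m` from `0`, at `t`. -/
noncomputable def sinPowPrimitive (m : ℕ) (t : ℝ) : ℝ := ∫ s in (0 : ℝ)..t, (t - s) * Real.sin s ^ m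

theorem sinPowPrimitive_zero (t : ℝ) : sinPowPrimitive 0 t = t ^ 2 / 2 := by
  simpa [sinPowPrimitive, Nat.factorial] using integral_sub_mul_pow_div_factorial 0 t

/-- This is the formula for `(sin ^ (m + 2))''` integrated twice from `0`, where `sin ^ (m + 2)` and
its derivative vanish. For any `F`, the function `(t - s) * F' s + F s` is a primitive of `(t - s) *
F'' s`. -/
theorem mul_sinPowPrimitive (m : ℕ) (t : ℝ) :
    (m + 2) * (m + 1) * sinPowPrimitive m t =
      Real.sin t ^ (m + 2) + (m + 2) ^ 2 * sinPowPrimitive (m + 2) t := by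
  have key : ∫ s in (0 : ℝ)..t, ((m + 2) * (m + 1) * ((t - s) * Real.sin s ^ m)
      - (m + 2) ^ 2 * ((t - s) * Real.sin s ^ (m + 2))) = Real.sin t ^ (m + 2) := by
    rw [intervalIntegral.integral_eq_sub_of_hasDerivAt (f := fun s =>
      (t - s) * ((m + 2) * (Real.sin s ^ (m + 1) * Real.cos s)) + Real.sin s ^ (m + 2))]
    · simp
    · intro s _
      have h₁ := (((Real.hasDerivAt_sin s).pow (m + 1)).mul (Real.hasDerivAt_cos s)).const_mul
        (m + 2 : ℝ)
      have h₂ := (((hasDerivAt_id s).const_sub t).mul h₁).add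
        ((Real.hasDerivAt_sin s).pow (m + 2))
      refine h₂.congr_deriv ?_
      have h₃ : Real.cos s * Real.cos s = 1 - Real.sin s ^ 2 := by
        rw [← Real.cos_sq', sq]
      simp only [Nat.add_sub_cancel, id, Pi.mul_apply, Pi.pow_apply]
      push_cast
      linear_combination (t - s) * (m + 2) * (m + 1) * Real.sin s ^ m * h₃
    · exact Continuous.intervalIntegrable (by fun_prop) _ _
  rw [intervalIntegral.integral_sub, intervalIntegral.integral_const_mul,
    intervalIntegral.integral_const_mul] at key
  · simp only [sinPowPrimitive]
    linarith
  all_goals exact Continuous.intervalIntegrable (by fun_prop) _ _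

theorem sinPowPrimitive_one (t : ℝ) : sinPowPrimitive 1 t = t - Real.sin t := by
  rw [sinPowPrimitive, intervalIntegral.integral_eq_sub_of_hasDerivAt (f := fun s =>
      -((t - s) * Real.cos s) - Real.sin s)]
  · simp
    ring
  · intro s _
    refine ((((hasDerivAt_id s).const_sub t).mul (Real.hasDerivAt_cos s)).neg.sub
        (Real.hasDerivAt_sin s)).congr_deriv ?_
    simp
  · exact Continuous.intervalIntegrable (by fun_prop) _ _

theorem sinPowPrimitive_nonneg (m : ℕ) {t : ℝ} (h₀ : 0 ≤ t) (h₁ : t ≤ Real.pi) :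
    0 ≤ sinPowPrimitive m t :=
  intervalIntegral.integral_nonneg h₀ fun _ hs =>
    mul_nonneg (sub_nonneg.2 hs.2)
      (pow_nonneg (Real.sin_nonneg_of_nonneg_of_le_pi hs.1 (hs.2.trans h₁)) _)

theorem sinPowPrimitive_le (m : ℕ) {t : ℝ} (h₀ : 0 ≤ t) (h₁ : t ≤ Real.pi / 2) :
    sinPowPrimitive m t ≤ t ^ 2 / 2 * Real.sin t ^ m := by
  rw [← sinPowPrimitive_zero, sinPowPrimitive, sinPowPrimitive,
    ← intervalIntegral.integral_mul_const]
  refine intervalIntegral.integral_mono_on h₀ (Continuous.intervalIntegrable (by fun_prop) _ _)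
    (Continuous.intervalIntegrable (by fun_prop) _ _) fun s hs => ?_
  have hπ := Real.pi_pos
  rw [pow_zero, mul_one]
  refine mul_le_mul_of_nonneg_left (pow_le_pow_left₀ ?_ ?_ _) (sub_nonneg.2 hs.2)
  · exact Real.sin_nonneg_of_nonneg_of_le_pi hs.1 (by linarith [hs.2])
  · exact Real.sin_le_sin_of_le_of_le_pi_div_two (by linarith [hs.1]) h₁ hs.2

/-- The Wallis recursion makes the two coefficients in `mul_sinPowPrimitive` equal after division,
so that the relation telescopes. -/
theorem sinPowPrimitive_div_sub (m : ℕ) (t : ℝ) :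
    sinPowPrimitive m t / wallisIntegral m -
        sinPowPrimitive (m + 2) t / wallisIntegral (m + 2) =
      Real.sin t ^ (m + 2) / (((m + 2 : ℕ) : ℝ) ^ 2 * wallisIntegral (m + 2)) := by
  have hW := wallisIntegral_pos m
  have h := mul_sinPowPrimitive m t
  rw [wallisIntegral_add_two]
  push_cast
  field_simp
  linarith

theorem hasSum_sinPowPrimitive_div (m : ℕ) {t : ℝ} (h₀ : 0 ≤ t) (h₁ : t < Real.pi / 2) :
    HasSum (fun i : ℕ => Real.sin t ^ (m + 2 * i + 2) /
        (((m + 2 * i + 2 : ℕ) : ℝ) ^ 2 * wallisIntegral (m + 2 * i + 2)))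
      (sinPowPrimitive m t / wallisIntegral m) := by
  have hπ := Real.pi_pos
  have hs₀ : 0 ≤ Real.sin t := Real.sin_nonneg_of_nonneg_of_le_pi h₀ (by linarith)
  have hs₁ : Real.sin t < 1 := by
    rw [← Real.sin_pi_div_two]
    exact Real.sin_lt_sin_of_lt_of_le_pi_div_two (by linarith) le_rfl h₁
  rw [hasSum_iff_tendsto_nat_of_nonneg fun i =>
    div_nonneg (pow_nonneg hs₀ _) (mul_nonneg (sq_nonneg _) (wallisIntegral_pos _).le)]
  -- The telescoping remainder is at most `t ^ 2 / 2 * (k * sin t ^ k)`, which tends to `0` since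
  -- `sin t < 1`; hence the strict bound `t < π / 2`.
  have hlim : Tendsto (fun k : ℕ => sinPowPrimitive k t / wallisIntegral k) atTop (𝓝 0) := by
    have hg : Tendsto (fun k : ℕ => t ^ 2 / 2 * (k * Real.sin t ^ k)) atTop (𝓝 0) := by
      simpa using (tendsto_self_mul_const_pow_of_lt_one hs₀ hs₁).const_mul (t ^ 2 / 2)
    refine squeeze_zero' (Eventually.of_forall fun k => div_nonneg
      (sinPowPrimitive_nonneg k h₀ (by linarith)) (wallisIntegral_pos k).le) ?_ hg
    filter_upwards [eventually_ge_atTop 1] with k hk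
    obtain ⟨k, rfl⟩ := Nat.exists_eq_add_of_le' hk
    rw [div_le_iff₀ (wallisIntegral_pos _)]
    refine (sinPowPrimitive_le _ h₀ h₁.le).trans ?_
    have h₂ : 0 ≤ t ^ 2 / 2 * Real.sin t ^ (k + 1) := by positivity
    have h₃ := mul_le_mul_of_nonneg_left (one_le_mul_wallisIntegral k) h₂
    push_cast
    linarith
  have hlim' : Tendsto (fun k : ℕ => sinPowPrimitive m t / wallisIntegral m -
      sinPowPrimitive (m + 2 * k) t / wallisIntegral (m + 2 * k)) atTop
      (𝓝 (sinPowPrimitive m t / wallisIntegral m)) := by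
    have h : Tendsto (fun k : ℕ => m + 2 * k) atTop atTop :=
      tendsto_atTop_mono (fun k => by change k ≤ _; omega) tendsto_id
    simpa using (hlim.comp h).const_sub (sinPowPrimitive m t / wallisIntegral m)
  refine hlim'.congr fun k => ?_
  have h := Finset.sum_range_sub'
    (fun k => sinPowPrimitive (m + 2 * k) t / wallisIntegral (m + 2 * k)) k
  rw [mul_zero, add_zero] at h
  rw [← h]
  exact Finset.sum_congr rfl fun i _ => sinPowPrimitive_div_sub (m + 2 * i) t

/-! ### Integration against `arccos x / x` -/

theorem integral_pow_mul_arccos (m : ℕ) :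
    ∫ x in (0 : ℝ)..1, x ^ m * Real.arccos x = wallisIntegral (m + 1) / (m + 1) := by
  have hsub := intervalIntegral.integral_comp_mul_deriv (a := 0) (b := Real.pi / 2)
    (f := Real.sin) (f' := Real.cos) (g := fun x => x ^ m * Real.arccos x)
    (fun x _ => Real.hasDerivAt_sin x) Real.continuous_cos.continuousOn
    ((continuous_pow m).mul Real.continuous_arccos)
  rw [Real.sin_zero, Real.sin_pi_div_two] at hsub
  rw [← hsub]
  -- Integration by parts after `x = sin θ`: the first two terms form the derivative of `(π / 2 - θ)
  -- * sin θ ^ (m + 1) / (m + 1)`, which vanishes at both ends.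
  have hcongr : ∫ x in (0 : ℝ)..Real.pi / 2,
      ((fun x => x ^ m * Real.arccos x) ∘ Real.sin) x * Real.cos x =
      ∫ x in (0 : ℝ)..Real.pi / 2,
        (Real.sin x ^ m * Real.cos x * (Real.pi / 2 - x) - Real.sin x ^ (m + 1) / (m + 1)
          + Real.sin x ^ (m + 1) / (m + 1)) := by
    refine intervalIntegral.integral_congr fun x hx => ?_
    rw [Set.uIcc_of_le (by positivity)] at hx
    have hπ := Real.pi_pos
    have h : Real.arccos (Real.sin x) = Real.pi / 2 - x := by
      rw [Real.arccos, Real.arcsin_sin (by linarith [hx.1]) hx.2]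
    simp only [Function.comp_apply, h]
    ring
  rw [hcongr, intervalIntegral.integral_add, intervalIntegral.integral_div,
    intervalIntegral.integral_eq_sub_of_hasDerivAt (f := fun x =>
      (Real.pi / 2 - x) * (Real.sin x ^ (m + 1) / (m + 1)))]
  · simp [wallisIntegral]
  · intro x _
    refine (((hasDerivAt_id x).const_sub (Real.pi / 2)).mul
      (((Real.hasDerivAt_sin x).pow (m + 1)).div_const (m + 1 : ℝ))).congr_deriv ?_
    simp only [id, Pi.pow_apply, Nat.add_sub_cancel]
    push_cast
    field_simp
    ring
  all_goals exact Continuous.intervalIntegrable (by fun_prop) _ _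

theorem ofReal_intervalIntegral_of_nonneg {f : ℝ → ℝ} {a b : ℝ} (hab : a ≤ b)
    (hf : IntervalIntegrable f volume a b) (h₀ : ∀ x ∈ Set.Ioc a b, 0 ≤ f x) :
    ENNReal.ofReal (∫ x in a..b, f x) = ∫⁻ x in Set.Ioc a b, ENNReal.ofReal (f x) := by
  rw [intervalIntegral.integral_of_le hab]
  exact ofReal_integral_eq_lintegral_ofReal
    ((intervalIntegrable_iff_integrableOn_Ioc_of_le hab).1 hf)
    ((ae_restrict_iff' measurableSet_Ioc).2 (ae_of_all _ h₀))

/-- The integrand is bounded: Jordan's inequality gives `arcsin x ≤ π / 2 * x`, so one factor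
`arcsin x` absorbs the pole of `1 / x`. -/
theorem intervalIntegrable_arcsin_pow_mul_arccos_div (k : ℕ) :
    IntervalIntegrable (fun x : ℝ => Real.arcsin x ^ (k + 1) / ((k + 1).factorial : ℝ)
      * (Real.arccos x / x)) volume 0 1 := by
  rw [intervalIntegrable_iff_integrableOn_Ioc_of_le zero_le_one]
  refine Measure.integrableOn_of_bounded (M := (Real.pi / 2) ^ (k + 1) * Real.pi) (by simp)
    (Measurable.aestronglyMeasurable (by fun_prop)) ?_
  refine (ae_restrict_iff' measurableSet_Ioc).2 (ae_of_all _ fun x hx => ?_)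
  have hπ := Real.pi_pos
  have h₀ : 0 ≤ Real.arcsin x := Real.arcsin_nonneg.2 hx.1.le
  have h₁ : Real.arcsin x ≤ Real.pi / 2 := Real.arcsin_le_pi_div_two x
  have h₂ : Real.arcsin x ≤ Real.pi / 2 * x := by
    have h := Real.mul_le_sin h₀ h₁
    rw [Real.sin_arcsin (by linarith [hx.1]) hx.2, div_mul_eq_mul_div, div_le_iff₀ hπ] at h
    linarith
  have h₃ := Real.arccos_nonneg x
  have hx₀ := hx.1
  rw [Real.norm_of_nonneg (by positivity)]
  have h₄ : Real.arcsin x ^ (k + 1) / ((k + 1).factorial : ℝ) ≤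
      (Real.pi / 2) ^ (k + 1) * x := by
    refine (div_le_self (by positivity) (by exact_mod_cast Nat.factorial_pos _)).trans ?_
    rw [pow_succ, pow_succ, mul_assoc]
    gcongr
  calc _ ≤ (Real.pi / 2) ^ (k + 1) * x * (Real.pi / x) := by
        gcongr
        exact Real.arccos_le_pi x
    _ = _ := by field_simp

/-! ### Iterated double integration of the sine expansions -/

/-- The term `sin t ^ (2 * j + p) / ((2 * j + p) ^ 2 * W)`, where `W` is the Wallis integral of
exponent `2 * j + p`. -/
noncomputable def sinPowTerm (p j : ℕ) (t : ℝ) : ℝ :=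
  Real.sin t ^ (2 * j + p) / (((2 * j + p : ℕ) : ℝ) ^ 2 * wallisIntegral (2 * j + p))

/-- The weight `1 / (2 * j + p) ^ 2`. -/
noncomputable def progressionWeight (p j : ℕ) : ℝ≥0∞ :=
  ENNReal.ofReal (1 / ((2 * j + p : ℕ) : ℝ) ^ 2)

theorem continuous_sinPowTerm (p j : ℕ) : Continuous (sinPowTerm p j) := by
  unfold sinPowTerm
  fun_prop

theorem sinPowTerm_nonneg (p j : ℕ) {t : ℝ} (h₀ : 0 ≤ t) (h₁ : t ≤ Real.pi) :
    0 ≤ sinPowTerm p j t :=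
  div_nonneg (pow_nonneg (Real.sin_nonneg_of_nonneg_of_le_pi h₀ h₁) _)
    (mul_nonneg (sq_nonneg _) (wallisIntegral_pos _).le)

theorem tsum_ofReal_sinPowTerm_of_lt (p j : ℕ) {t : ℝ} (h₀ : 0 ≤ t) (h₁ : t < Real.pi / 2) :
    (∑' i, if j < i then ENNReal.ofReal (sinPowTerm p i t) else 0) =
      ENNReal.ofReal (sinPowPrimitive (2 * j + p) t / wallisIntegral (2 * j + p)) := by
  have hs := hasSum_sinPowPrimitive_div (2 * j + p) h₀ h₁
  have hinj : Function.Injective fun i : ℕ => j + 1 + i := fun a b h => by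
    simpa using h
  rw [← hs.tsum_eq, ENNReal.ofReal_tsum_of_nonneg _ hs.summable, ← hinj.tsum_eq]
  · refine tsum_congr fun i => ?_
    rw [if_pos (by omega), sinPowTerm,
      show 2 * (j + 1 + i) + p = 2 * j + p + 2 * i + 2 by ring]
  · intro i hi
    rw [Function.mem_support, ne_eq, ite_eq_right_iff, not_forall] at hi
    exact ⟨i - (j + 1), by have := hi.1; change j + 1 + (i - (j + 1)) = i; omega⟩
  · intro i
    have hπ := Real.pi_pos
    exact div_nonneg (pow_nonneg (Real.sin_nonneg_of_nonneg_of_le_pi h₀ (by linarith)) _)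
      (mul_nonneg (sq_nonneg _) (wallisIntegral_pos _).le)

/-- The engine of the induction: each double integration produces one inverse square and one inner
summation of the nested sum. -/
theorem lintegral_sub_mul_sinPowTerm (p j : ℕ) {t : ℝ} (h₀ : 0 ≤ t) (h₁ : t < Real.pi / 2) :
    ∫⁻ s in Set.Ioc 0 t, ENNReal.ofReal ((t - s) * sinPowTerm p j s) =
      progressionWeight p j * ∑' i, if j < i then ENNReal.ofReal (sinPowTerm p i t) else 0 := by
  have hπ := Real.pi_pos
  have hcont := continuous_sinPowTerm p j
  rw [tsum_ofReal_sinPowTerm_of_lt p j h₀ h₁, progressionWeight,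
    ← ENNReal.ofReal_mul (by positivity), ← ofReal_intervalIntegral_of_nonneg h₀
      (Continuous.intervalIntegrable (by fun_prop) _ _)]
  · congr 1
    rw [sinPowPrimitive, div_mul_div_comm, one_mul, ← intervalIntegral.integral_div]
    refine intervalIntegral.integral_congr fun s _ => ?_
    exact (mul_div_assoc _ _ _).symm
  · exact fun s hs => mul_nonneg (sub_nonneg.2 hs.2)
      (sinPowTerm_nonneg p j hs.1.le (by linarith [hs.2]))

/-- An expansion of `t ^ p / p!` in powers of `sin t` propagates to `t ^ (2 * n + p)`. -/
theorem tsum_nestedSum_mul_sinPowTerm {p : ℕ} {κ : ℝ} (hκ : 0 ≤ κ)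
    (hbase : ∀ t : ℝ, 0 ≤ t → t < Real.pi / 2 →
      ∑' j, ENNReal.ofReal (sinPowTerm p j t) =
        ENNReal.ofReal (κ * (t ^ p / (p.factorial : ℝ))))
    (n : ℕ) {t : ℝ} (h₀ : 0 ≤ t) (h₁ : t < Real.pi / 2) :
    ∑' j, nestedSum (progressionWeight p) n j * ENNReal.ofReal (sinPowTerm p j t) =
      ENNReal.ofReal (κ * (t ^ (2 * n + p) / ((2 * n + p).factorial : ℝ))) := by
  induction n generalizing t with
  | zero => simpa [nestedSum] using hbase t h₀ h₁
  | succ n ih =>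
    have hint : ENNReal.ofReal (κ * (t ^ (2 * (n + 1) + p) /
        ((2 * (n + 1) + p).factorial : ℝ))) =
        ∫⁻ s in Set.Ioc 0 t, ENNReal.ofReal
          ((t - s) * (κ * (s ^ (2 * n + p) / ((2 * n + p).factorial : ℝ)))) := by
      rw [← ofReal_intervalIntegral_of_nonneg h₀
        (Continuous.intervalIntegrable (by fun_prop) _ _)]
      · rw [show 2 * (n + 1) + p = 2 * n + p + 2 by ring, ← integral_sub_mul_pow_div_factorial,
          ← intervalIntegral.integral_const_mul]
        congr 2
        ext s
        ring
      · intro s hs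
        have := hs.1.le
        exact mul_nonneg (sub_nonneg.2 hs.2) (by positivity)
    have hexp : ∫⁻ s in Set.Ioc 0 t, ENNReal.ofReal
          ((t - s) * (κ * (s ^ (2 * n + p) / ((2 * n + p).factorial : ℝ)))) =
        ∫⁻ s in Set.Ioc 0 t, ∑' j, nestedSum (progressionWeight p) n j *
          ENNReal.ofReal ((t - s) * sinPowTerm p j s) := by
      refine setLIntegral_congr_fun measurableSet_Ioc fun s hs => ?_
      have hts : 0 ≤ t - s := sub_nonneg.2 hs.2
      simp only [ENNReal.ofReal_mul hts]
      rw [← ih hs.1.le (hs.2.trans_lt h₁), ← ENNReal.tsum_mul_left]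
      exact tsum_congr fun j => mul_left_comm _ _ _
    have hmeas : ∀ j, Measurable fun s => ENNReal.ofReal ((t - s) * sinPowTerm p j s) :=
      fun j => by
        have := (continuous_sinPowTerm p j).measurable
        fun_prop
    rw [hint, hexp, lintegral_tsum fun j => ((hmeas j).const_mul _).aemeasurable]
    simp only [lintegral_const_mul _ (hmeas _), lintegral_sub_mul_sinPowTerm p _ h₀ h₁,
      ← ENNReal.tsum_mul_left, ← ENNReal.tsum_mul_right, nestedSum]
    -- With the new, larger index outermost, the inner sum over smaller indices is the recursion
    -- defining `nestedSum`.
    rw [ENNReal.tsum_comm]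
    refine tsum_congr fun j => tsum_congr fun i => ?_
    split_ifs <;> ring

/-! ### From the expansions to the series -/

theorem lintegral_sinPowTerm_arcsin_mul_arccos_div {p : ℕ} (hp : 0 < p) (j : ℕ) :
    ∫⁻ x in Set.Ioc (0 : ℝ) 1, ENNReal.ofReal
        (sinPowTerm p j (Real.arcsin x) * (Real.arccos x / x)) =
      ENNReal.ofReal (1 / ((2 * j + p : ℕ) : ℝ) ^ 3) := by
  obtain ⟨m, hm⟩ : ∃ m, 2 * j + p = m + 1 := ⟨2 * j + p - 1, by omega⟩
  have hW := wallisIntegral_pos (m + 1)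
  have hcongr : ∫⁻ x in Set.Ioc (0 : ℝ) 1, ENNReal.ofReal
        (sinPowTerm p j (Real.arcsin x) * (Real.arccos x / x)) =
      ∫⁻ x in Set.Ioc (0 : ℝ) 1, ENNReal.ofReal
        (x ^ m * Real.arccos x / (((m + 1 : ℕ) : ℝ) ^ 2 * wallisIntegral (m + 1))) := by
    refine setLIntegral_congr_fun measurableSet_Ioc fun x hx => ?_
    have hx₀ := hx.1
    simp only [sinPowTerm, hm]
    rw [Real.sin_arcsin (by linarith) hx.2]
    congr 1
    field_simp
    ring
  have hcont := Real.continuous_arccos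
  rw [hcongr, ← ofReal_intervalIntegral_of_nonneg zero_le_one
    (Continuous.intervalIntegrable (by fun_prop) _ _), intervalIntegral.integral_div,
    integral_pow_mul_arccos, hm]
  · congr 1
    push_cast
    field_simp
  · intro x hx
    have h₁ := Real.arccos_nonneg x
    have h₂ := hx.1
    positivity

theorem tsum_nestedSum_div_cube {p : ℕ} (hp : 0 < p) {κ : ℝ} (hκ : 0 ≤ κ)
    (hbase : ∀ t : ℝ, 0 ≤ t → t < Real.pi / 2 →
      ∑' j, ENNReal.ofReal (sinPowTerm p j t) =
        ENNReal.ofReal (κ * (t ^ p / (p.factorial : ℝ)))) (n : ℕ) :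
    ∑' j, ENNReal.ofReal (1 / ((2 * j + p : ℕ) : ℝ) ^ 3) *
        nestedSum (progressionWeight p) n j =
      ENNReal.ofReal (κ * ∫ x in (0 : ℝ)..1,
        Real.arcsin x ^ (2 * n + p) / ((2 * n + p).factorial : ℝ) * (Real.arccos x / x)) := by
  have hII : IntervalIntegrable (fun x : ℝ =>
      Real.arcsin x ^ (2 * n + p) / ((2 * n + p).factorial : ℝ) * (Real.arccos x / x))
      volume 0 1 := by
    obtain ⟨k, hk⟩ : ∃ k, 2 * n + p = k + 1 := ⟨2 * n + p - 1, by omega⟩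
    rw [hk]
    exact intervalIntegrable_arcsin_pow_mul_arccos_div k
  have hmeas : ∀ j, Measurable fun x =>
      ENNReal.ofReal (sinPowTerm p j (Real.arcsin x) * (Real.arccos x / x)) := fun j => by
    have := (continuous_sinPowTerm p j).measurable
    fun_prop
  rw [← intervalIntegral.integral_const_mul, ofReal_intervalIntegral_of_nonneg zero_le_one
    (hII.const_mul κ)]
  · have hexp : ∫⁻ x in Set.Ioc (0 : ℝ) 1, ENNReal.ofReal (κ *
          (Real.arcsin x ^ (2 * n + p) / ((2 * n + p).factorial : ℝ) * (Real.arccos x / x))) =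
        ∫⁻ x in Set.Ioc (0 : ℝ) 1, ∑' j, nestedSum (progressionWeight p) n j *
          ENNReal.ofReal (sinPowTerm p j (Real.arcsin x) * (Real.arccos x / x)) := by
      -- The endpoint `x = 1` is discarded: there `arcsin x = π / 2`, outside the range of the
      -- expansion.
      rw [← restrict_Ioo_eq_restrict_Ioc]
      refine setLIntegral_congr_fun measurableSet_Ioo fun x hx => ?_
      have hx₀ := hx.1
      have h₀ : 0 ≤ Real.arcsin x := Real.arcsin_nonneg.2 hx₀.le
      have h : 0 ≤ Real.arccos x / x := div_nonneg (Real.arccos_nonneg x) hx₀.le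
      simp only [← mul_assoc, ENNReal.ofReal_mul' h]
      rw [ENNReal.tsum_mul_right, tsum_nestedSum_mul_sinPowTerm hκ hbase n h₀
        (Real.arcsin_lt_pi_div_two.2 hx.2)]
    rw [hexp, lintegral_tsum fun j => ((hmeas j).const_mul _).aemeasurable]
    refine tsum_congr fun j => ?_
    rw [lintegral_const_mul _ (hmeas j), lintegral_sinPowTerm_arcsin_mul_arccos_div hp, mul_comm]
  · intro x hx
    have h₀ : 0 ≤ Real.arcsin x := Real.arcsin_nonneg.2 hx.1.le
    have h : 0 ≤ Real.arccos x / x := div_nonneg (Real.arccos_nonneg x) hx.1.le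
    positivity

theorem integral_arcsin_pow_mul_arccos_div_nonneg (k : ℕ) :
    0 ≤ ∫ x in (0 : ℝ)..1, Real.arcsin x ^ k / (k.factorial : ℝ) * (Real.arccos x / x) :=
  intervalIntegral.integral_nonneg zero_le_one fun x hx => by
    have h₀ : 0 ≤ Real.arcsin x := Real.arcsin_nonneg.2 hx.1
    have h : 0 ≤ Real.arccos x / x := div_nonneg (Real.arccos_nonneg x) hx.1
    positivity

theorem hasSum_strictAnti_progression {p : ℕ} (hp : 0 < p) {κ : ℝ} (hκ : 0 ≤ κ)
    (hbase : ∀ t : ℝ, 0 ≤ t → t < Real.pi / 2 →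
      ∑' j, ENNReal.ofReal (sinPowTerm p j t) =
        ENNReal.ofReal (κ * (t ^ p / (p.factorial : ℝ)))) (n : ℕ) :
    HasSum (fun v : {v : Fin (n + 1) → ℕ | StrictAnti v} =>
        multipleSumTerm (threeTwos n) fun j => 2 * v.1 j + p)
      (κ * ∫ x in (0 : ℝ)..1,
        Real.arcsin x ^ (2 * n + p) / ((2 * n + p).factorial : ℝ) * (Real.arccos x / x)) := by
  have h := tsum_nestedSum_div_cube hp hκ hbase n
  rw [← tsum_strictAnti_eq_tsum_nestedSum] at h
  have hterm : ∀ v : {v : Fin (n + 1) → ℕ | StrictAnti v},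
      ENNReal.ofReal (1 / ((2 * v.1 0 + p : ℕ) : ℝ) ^ 3) *
        ∏ j : Fin n, progressionWeight p (v.1 j.succ) =
      ENNReal.ofReal (multipleSumTerm (threeTwos n) fun j => 2 * v.1 j + p) := fun v => by
    rw [multipleSumTerm_threeTwos, ENNReal.ofReal_mul (by positivity),
      ENNReal.ofReal_prod_of_nonneg fun j _ => by positivity]
    rfl
  simp only [hterm] at h
  have hnonneg : ∀ v : {v : Fin (n + 1) → ℕ | StrictAnti v},
      0 ≤ multipleSumTerm (threeTwos n) fun j => 2 * v.1 j + p := fun v => by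
    rw [multipleSumTerm_threeTwos]
    positivity
  have hsum : Summable fun v : {v : Fin (n + 1) → ℕ | StrictAnti v} =>
      multipleSumTerm (threeTwos n) fun j => 2 * v.1 j + p := by
    -- The extended sum equals an `ENNReal.ofReal`, hence is finite; this is the convergence of the
    -- series.
    refine (ENNReal.summable_toReal (h.trans_ne ENNReal.ofReal_ne_top)).congr fun v => ?_
    exact ENNReal.toReal_ofReal (hnonneg v)
  rw [← ENNReal.ofReal_tsum_of_nonneg hnonneg hsum, ENNReal.ofReal_eq_ofReal_iff
    (tsum_nonneg hnonneg)
    (mul_nonneg hκ (integral_arcsin_pow_mul_arccos_div_nonneg _))] at h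
  exact h ▸ hsum.hasSum

/-! ### The two base expansions and the conclusion -/

theorem tsum_sinPowTerm_one {t : ℝ} (h₀ : 0 ≤ t) (h₁ : t < Real.pi / 2) :
    ∑' j, ENNReal.ofReal (sinPowTerm 1 j t) =
      ENNReal.ofReal (1 * (t ^ 1 / (Nat.factorial 1 : ℝ))) := by
  have hπ := Real.pi_pos
  have hs := hasSum_sinPowPrimitive_div 1 h₀ h₁
  have hs' : HasSum (fun j => sinPowTerm 1 j t) t := by
    -- The telescoped series with `m = 1` starts at exponent 3 and sums to `t - sin t`; the missing
    -- term `j = 0` is `sin t`.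
    refine (hasSum_nat_add_iff' 1).1 ?_
    have hval : t - ∑ i ∈ Finset.range 1, sinPowTerm 1 i t =
        sinPowPrimitive 1 t / wallisIntegral 1 := by
      simp [sinPowPrimitive_one, wallisIntegral_one, sinPowTerm]
    rw [hval]
    refine hs.congr_fun fun i => ?_
    rw [sinPowTerm, show 2 * (i + 1) + 1 = 1 + 2 * i + 2 by ring]
  rw [← ENNReal.ofReal_tsum_of_nonneg (fun j => sinPowTerm_nonneg 1 j h₀ (by linarith))
    hs'.summable, hs'.tsum_eq]
  simp

/-- The telescoped series with `m = 0`; the constant `2 / π` is `1 / W 0`. -/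
theorem tsum_sinPowTerm_two {t : ℝ} (h₀ : 0 ≤ t) (h₁ : t < Real.pi / 2) :
    ∑' j, ENNReal.ofReal (sinPowTerm 2 j t) =
      ENNReal.ofReal (2 / Real.pi * (t ^ 2 / (Nat.factorial 2 : ℝ))) := by
  have hπ := Real.pi_pos
  have hs := hasSum_sinPowPrimitive_div 0 h₀ h₁
  simp only [zero_add] at hs
  change HasSum (fun j => sinPowTerm 2 j t) _ at hs
  rw [← ENNReal.ofReal_tsum_of_nonneg (fun j => sinPowTerm_nonneg 2 j h₀ (by linarith))
    hs.summable, hs.tsum_eq, sinPowPrimitive_zero, wallisIntegral_zero]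
  congr 1
  simp only [Nat.factorial]
  push_cast
  field_simp

theorem multipleSumTerm_threeTwos_two_mul {n : ℕ} (m : Fin (n + 1) → ℕ) :
    multipleSumTerm (threeTwos n) (fun j => 2 * m j) =
      multipleSumTerm (threeTwos n) m / 2 ^ (2 * n + 3) := by
  have h : ∀ j : Fin n, (1 : ℝ) / ((2 * m j.succ : ℕ) : ℝ) ^ 2 =
      (1 / 2 ^ 2) * (1 / (m j.succ : ℝ) ^ 2) := fun j => by
    push_cast
    rw [mul_pow, div_mul_div_comm, one_mul]
  rw [multipleSumTerm_threeTwos, multipleSumTerm_threeTwos, Finset.prod_congr rfl fun j _ => h j,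
    Finset.prod_mul_distrib, Finset.prod_const, Finset.card_univ, Fintype.card_fin, pow_add,
    pow_mul]
  push_cast
  rw [mul_pow, one_div_pow]
  field_simp

theorem theorem5 (n : ℕ) :
    (Summable (fun m : decreasingTuples (n + 1) => multipleSumTerm (threeTwos n) m) ∧
      IntervalIntegrable
        (fun x : ℝ => Real.arcsin x ^ (2 * n + 2) / ((2 * n + 2).factorial : ℝ)
          * (Real.arccos x / x)) MeasureTheory.volume 0 1 ∧
      multipleZeta (threeTwos n) / (2 : ℝ) ^ (2 * n + 3) =
        2 / Real.pi * ∫ x in (0 : ℝ)..1,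
          Real.arcsin x ^ (2 * n + 2) / ((2 * n + 2).factorial : ℝ)
            * (Real.arccos x / x)) ∧
    (Summable (fun m : oddDecreasingTuples (n + 1) => multipleSumTerm (threeTwos n) m) ∧
      IntervalIntegrable
        (fun x : ℝ => Real.arcsin x ^ (2 * n + 1) / ((2 * n + 1).factorial : ℝ)
          * (Real.arccos x / x)) MeasureTheory.volume 0 1 ∧
      multipleT (threeTwos n) =
        ∫ x in (0 : ℝ)..1,
          Real.arcsin x ^ (2 * n + 1) / ((2 * n + 1).factorial : ℝ)
            * (Real.arccos x / x)) := by
  have hz : HasSum (fun m : decreasingTuples (n + 1) =>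
      multipleSumTerm (threeTwos n) m / 2 ^ (2 * n + 3))
      (2 / Real.pi * ∫ x in (0 : ℝ)..1,
        Real.arcsin x ^ (2 * n + 2) / ((2 * n + 2).factorial : ℝ) * (Real.arccos x / x)) := by
    rw [← (decreasingTuplesEquiv (n + 1)).hasSum_iff]
    refine (hasSum_strictAnti_progression two_pos (by positivity)
      (fun t h₀ h₁ => tsum_sinPowTerm_two h₀ h₁) n).congr_fun ?_
    intro v
    -- The entries `2 * v + 2` of the even progression are the doubles of `v + 1`.
    exact (multipleSumTerm_threeTwos_two_mul _).symm
  have ht : HasSum (fun m : oddDecreasingTuples (n + 1) => multipleSumTerm (threeTwos n) m)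
      (∫ x in (0 : ℝ)..1,
        Real.arcsin x ^ (2 * n + 1) / ((2 * n + 1).factorial : ℝ) * (Real.arccos x / x)) := by
    rw [← (oddDecreasingTuplesEquiv (n + 1)).hasSum_iff]
    have h := hasSum_strictAnti_progression one_pos zero_le_one
      (fun t h₀ h₁ => tsum_sinPowTerm_one h₀ h₁) n
    rwa [one_mul] at h
  refine ⟨⟨?_, intervalIntegrable_arcsin_pow_mul_arccos_div _, ?_⟩, ht.summable,
    intervalIntegrable_arcsin_pow_mul_arccos_div _, ht.tsum_eq⟩
  · exact (summable_div_const_iff (by positivity)).1 hz.summable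
  · rw [multipleZeta, ← tsum_div_const, hz.tsum_eq]
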